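/- For $m\in\mathbb N$ write $\langle m\rangle=\{-\lfloor m/2\rfloor,\dots,\lfloor m/2\rfloor\}$, and let $\log$ be to base $2$. The $k$-Tree algorithm with parameters $k,n,m\in\mathbb N$ ($k$ a power of $2$) and $p\in(0,1]$ takes as input lists $L^0_1,\dots,L^0_k$, each of $n$ integers from $\langle m\rangle$. For $d=1,\dots,\log k$ and $1\le i\le k/2^d$ it forms the list $L^d_i$ of all sums $a+b$ with $a$ an entry of $L^{d-1}_{2i-1}$, $b$ an entry of $L^{d-1}_{2i}$ and $|a+b|\le p^d m/2$, keeping one copy of a sum for every pair of entries that produces it. If $0$ occurs in $L^{\log k}_1$, it outputs indices $(\ell_1,\dots,\ell_k)$ in the input lists that led to this sum; otherwise it outputs $\bot$. The algorithm succeeds if it outputs indices with $\sum_{i} L^0_i[\ell_i]=0$. Let all $kn$ input entries be independent and uniform on $\langle m\rangle$. Write $\Pr[\text{success}]$ for the probability of success over the inputs, and define the complexity as the expected total size $\mathbb E\big[\sum_{d=0}^{\log k}\sum_{i=1}^{k/2^d}|L^d_i|\big]$ of all lists involved. **Statement.** Let $k,n:\mathbb N\to\mathbb N$ be functions such that for every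 $m$, $k(m)\ge 4$ is a power of $2$. Set $p(m)=m^{-1/(\log k(m)+1)}$ and $c(m)=p(m)\cdot n(m)$, and suppose that $k=o(1/p)$ and $k=o(n^{1/2})$ as $m\to\infty$. Then the $k$-Tree algorithm with parameters $k=k(m)$, $n=n(m)$, $m$ and $p=p(m)$ satisfies, as $m\to\infty$, $$\frac{c^k}{1+c^k}\,(1-o(1))\;\le\;\Pr[\text{success}]\;\le\; c^k\,(1+o(1)),$$ and $$\text{complexity}\;\in\; kn\left(1+\sum_{d=1}^{\log k}\frac{c^{2^d-1}}{2^d}\right)(1\pm o(1)).$$ -/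

import Mathlib

open Filter Topology Asymptotics

noncomputable section

namespace KTree

/-- The integer interval `{-⌊m/2⌋, …, ⌊m/2⌋}` from which the inputs are drawn. -/
def range (m : ℕ) : Finset ℤ := Finset.Icc (-((m : ℤ) / 2)) ((m : ℤ) / 2)

/-- The filtering parameter `p = m ^ (-1 / (log₂ k + 1))`, for `k` a power of two. -/
def filterParam (k m : ℕ) : ℝ := (m : ℝ) ^ (-1 / ((Nat.log 2 k : ℝ) + 1))

/-- An element of a list handled by the algorithm: an integer (a sum of entries of consecutive
input lists), together with the positions in those input lists that led to it, in order. -/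
structure Entry (n : ℕ) where
  value : ℤ
  indices : List (Fin n)

/-- The entry formed from one entry of each of two lists. -/
def Entry.combine {n : ℕ} (a b : Entry n) : Entry n :=
  ⟨a.value + b.value, a.indices ++ b.indices⟩

/-- `Merge(A, B, τ)`: all sums `a + b` with `a ∈ A`, `b ∈ B` and `|a + b| ≤ τ`; one copy is kept
for each such pair, so duplicates are maintained. -/
def merge {n : ℕ} (A B : List (Entry n)) (τ : ℝ) : List (Entry n) :=
  ((A.product B).map fun ab => ab.1.combine ab.2).filter fun e => decide (|(e.value : ℝ)| ≤ τ)

/-- The lists computed by the algorithm on input `L`. With indices counted from `0`,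
`lists m p L d i` is the list `L^d_{i+1}`; it is meaningful for `i < k / 2 ^ d`. The threshold in
round `d` is `p ^ d * (m / 2)`. -/
def lists {k n : ℕ} (m : ℕ) (p : ℝ) (L : Fin k → Fin n → ℤ) : ℕ → ℕ → List (Entry n)
  | 0, i => if h : i < k then (List.finRange n).map fun j => ⟨L ⟨i, h⟩ j, [j]⟩ else []
  | d + 1, i =>
      merge (lists m p L d (2 * i)) (lists m p L d (2 * i + 1)) (p ^ (d + 1) * ((m : ℝ) / 2))

/-- The output of the algorithm: the indices that led to an occurrence of `0` in the final list,
or `none` (failure) if the final list does not contain `0`. -/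
def output {k n : ℕ} (m : ℕ) (p : ℝ) (L : Fin k → Fin n → ℤ) : Option (List (Fin n)) :=
  ((lists m p L (Nat.log 2 k) 0).find? fun e => decide (e.value = 0)).map Entry.indices

/-- The algorithm succeeds on `L`: it outputs indices `(ℓ₁, …, ℓₖ)` with `∑ i, L i (ℓ i) = 0`. -/
def Succeeds {k n : ℕ} (m : ℕ) (p : ℝ) (L : Fin k → Fin n → ℤ) : Prop :=
  ∃ l : Fin k → Fin n, output m p L = some (List.ofFn l) ∧ ∑ i, L i (l i) = 0

/-- The total size of all lists (input lists included) involved in the run on `L`. -/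
def totalSize {k n : ℕ} (m : ℕ) (p : ℝ) (L : Fin k → Fin n → ℤ) : ℕ :=
  ∑ d ∈ Finset.range (Nat.log 2 k + 1), ∑ i ∈ Finset.range (k / 2 ^ d), (lists m p L d i).length

/-- The law of the input: `k` lists of `n` independent uniform elements of `range m`, that is, the
uniform distribution on all such inputs. -/
def inputLaw (k n m : ℕ) : MeasureTheory.Measure (Fin k → Fin n → range m) :=
  ProbabilityTheory.uniformOn Set.univ

/-- The probability that the algorithm succeeds. -/
def successProb (k n m : ℕ) (p : ℝ) : ℝ :=
  (inputLaw k n m).real {L | Succeeds m p fun i j => (L i j : ℤ)}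

/-- The complexity: the expected total size of all lists involved. -/
def complexity (k n m : ℕ) (p : ℝ) : ℝ :=
  ∫ L, (totalSize m p fun i j => (L i j : ℤ) : ℝ) ∂(inputLaw k n m)

end KTree

end

/-!
The proof is the second moment method, carried out by recursion over the rounds. Let `cnt p d i x`
be the number of times the value `x` occurs in list `i` of round `d`. One merge turns multiplicities
into a truncated convolution (`mult_merge`), and the two lists being merged depend on disjoint sets
of inputs, so they are independent (`expect_cnt_mul`). Hence first and second moments of `cnt` in
round `d + 1` are explicit sums of products of those in round `d`.

*First moments.* With `width d` the number of values allowed in round `d`, put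
`peak 0 = n / width 0` and `peak (d + 1) = peak d ^ 2 * width d`. Then `E[cnt p d i x] ≤ peak d`,
and since only a fraction `p` of the window is lost at its boundary, also
`E[cnt p d i x] ≥ peak d * (1 - p) ^ (2 ^ d - 1)` for every allowed `x` (`expect_cnt_le`,
`le_expect_cnt`). As `width (d + 1) = p * width d` up to a factor `1 + O(p)`, the expected length
`peak d * width d` of a list is `n * c ^ (2 ^ d - 1)` up to `(1 + 4 * p) ^ (2 ^ d - 1)`, and
`peak (log k) = c ^ k` up to `(1 + 4 * p) ^ k` (`peak_mul_width_bounds`, `peak_bounds`). All these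
errors are `1 + o(1)` because `k * p → 0`. Summing expected lengths gives the complexity, and
Markov's inequality gives the upper bound on the success probability.

*Second moments.* A bound of the form `E[cnt x * cnt y] ≤ A + B * 1[x = y]` is preserved by a merge:
`A` becomes `A ^ 2 * width ^ 2 + 2 * A * B * width` and `B` becomes `B ^ 2 * width`
(`sum_sum_add_ite_le`), so that `B` is `peak`. The cross term, which accounts for pairs of index
tuples sharing some but not all positions, is relatively small by a factor
`1 / (peak d * width d) ≈ p / c ^ 2 ^ d`, and solving the recursion gives
`E[X ^ 2] ≤ (P ^ 2 + P) * (1 + o(1))` for the number `X` of zeros in the last list, with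
`P = peak (log k)` (`expect_cnt_mul_cnt_le`, `le_successProb`). The Cauchy–Schwarz inequality
`E[X] ^ 2 ≤ E[X ^ 2] * Pr[X > 0]` then yields the lower bound `P / (1 + P) * (1 - o(1))`.
-/

namespace KTree

open scoped BigOperators

/-! ### Averages over a finite product -/

/-- Functions of disjoint sets of coordinates are independent under the uniform distribution on
`ι → α`. -/
theorem expect_mul_of_dependsOn {ι α : Type*} [Fintype ι] [DecidableEq ι] [Fintype α] {S : Set ι}
    {f g : (ι → α) → ℝ} (hf : DependsOn f S) (hg : DependsOn g Sᶜ) :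
    𝔼 L, f L * g L = (𝔼 L, f L) * 𝔼 L, g L := by
  classical
  rcases isEmpty_or_nonempty (ι → α) with h | h
  · simp
  have hinv : Function.Involutive fun q : (ι → α) × (ι → α) =>
      (S.piecewise q.1 q.2, S.piecewise q.2 q.1) := by
    intro q
    ext i <;> by_cases hi : i ∈ S <;> simp [hi]
  -- Exchanging the coordinates outside `S` between two inputs is a bijection on pairs of inputs.
  have key : 𝔼 q : (ι → α) × (ι → α), f q.1 * g q.2 =
      𝔼 q : (ι → α) × (ι → α), f q.1 * g q.1 := by
    refine Fintype.expect_bijective _ hinv.bijective _ _ fun q => ?_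
    have h1 : f (S.piecewise q.1 q.2) = f q.1 := hf fun i hi => by simp [hi]
    have h2 : g (S.piecewise q.1 q.2) = g q.2 := hg fun i hi => by
      have : i ∉ S := hi
      simp [this]
    simp only [h1, h2]
  rw [Fintype.expect_mul_expect, ← Finset.expect_product', Finset.univ_product_univ, key,
    ← Finset.univ_product_univ, Finset.expect_product]
  simp

theorem expect_apply {ι α : Type*} [Fintype ι] [DecidableEq ι] [Fintype α] [Nonempty α] (i : ι)
    (g : α → ℝ) : 𝔼 L : ι → α, g (L i) = 𝔼 a, g a := by
  rw [Fintype.expect_equiv (Equiv.funSplitAt i α) (fun L : ι → α => g (L i))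
    (fun q => g q.1) (fun _ => rfl), ← Finset.univ_product_univ, Finset.expect_product]
  simp

/-- The second moment method: by the Cauchy–Schwarz inequality, a variable vanishing outside an
event bounds the probability of that event from below. -/
theorem sq_expect_le {Ω : Type*} [Fintype Ω] (X : Ω → ℝ) (s : Set Ω) [DecidablePred (· ∈ s)]
    (hX : ∀ ω, ω ∉ s → X ω = 0) :
    (𝔼 ω, X ω) ^ 2 ≤ (𝔼 ω, X ω ^ 2) * 𝔼 ω, if ω ∈ s then (1 : ℝ) else 0 := by
  have h := Finset.sum_mul_sq_le_sq_mul_sq Finset.univ X fun ω => if ω ∈ s then (1 : ℝ) else 0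
  have h1 : ∀ ω, X ω * (if ω ∈ s then (1 : ℝ) else 0) = X ω := fun ω => by
    by_cases hω : ω ∈ s <;> simp [hω, hX]
  have h2 : ∀ ω, (if ω ∈ s then (1 : ℝ) else 0) ^ 2 = if ω ∈ s then (1 : ℝ) else 0 := fun ω => by
    split_ifs <;> simp
  simp only [h1, h2] at h
  simp only [Fintype.expect_eq_sum_div_card, div_pow]
  rw [div_mul_div_comm, ← sq]
  gcongr

/-! ### Multiplicities in lists of entries -/

section Multiplicity

variable {n : ℕ}

/-- The number of occurrences of the value `x` in a list of entries, as a real number. -/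
noncomputable def mult (l : List (Entry n)) (x : ℤ) : ℝ :=
  (l.map fun e => if e.value = x then (1 : ℝ) else 0).sum

theorem mult_nonneg (l : List (Entry n)) (x : ℤ) : 0 ≤ mult l x := by
  refine List.sum_nonneg fun y hy => ?_
  obtain ⟨e, -, rfl⟩ := List.mem_map.1 hy
  split_ifs <;> simp

theorem mult_eq_zero {l : List (Entry n)} {x : ℤ} (h : ∀ e ∈ l, e.value ≠ x) : mult l x = 0 := by
  refine List.sum_eq_zero fun y hy => ?_
  obtain ⟨e, he, rfl⟩ := List.mem_map.1 hy
  simp [h e he]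

theorem one_le_mult {l : List (Entry n)} {e : Entry n} (he : e ∈ l) : 1 ≤ mult l e.value := by
  induction l with
  | nil => simp at he
  | cons a l ih =>
    have := mult_nonneg l e.value
    rcases List.mem_cons.1 he with rfl | he
    · simpa [mult] using this
    · have h1 := ih he
      simp only [mult, List.map_cons, List.sum_cons] at h1 ⊢
      split_ifs <;> linarith

theorem sum_map_value (l : List (Entry n)) {S : Finset ℤ} (h : ∀ e ∈ l, e.value ∈ S)
    (g : ℤ → ℝ) : (l.map fun e => g e.value).sum = ∑ a ∈ S, mult l a * g a := by
  induction l with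
  | nil => simp [mult]
  | cons e l ih =>
    have h1 := ih fun e' he' => h e' (List.mem_cons_of_mem _ he')
    have h2 : e.value ∈ S := h e List.mem_cons_self
    simp only [mult, List.map_cons, List.sum_cons, add_mul, Finset.sum_add_distrib, h1, ite_mul,
      one_mul, zero_mul, Finset.sum_ite_eq, h2, if_true]

theorem length_eq_sum_mult (l : List (Entry n)) {S : Finset ℤ} (h : ∀ e ∈ l, e.value ∈ S) :
    (l.length : ℝ) = ∑ a ∈ S, mult l a := by
  simpa using sum_map_value l h fun _ => 1

theorem sum_map_filter {β : Type*} (l : List β) (P : β → Prop) [DecidablePred P] (h : β → ℝ) :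
    ((l.filter fun b => decide (P b)).map h).sum = (l.map fun b => if P b then h b else 0).sum := by
  induction l with
  | nil => simp
  | cons b l ih => by_cases hb : P b <;> simp [hb, ih]

theorem sum_map_product {β γ : Type*} (A : List β) (B : List γ) (F : β × γ → ℝ) :
    ((A.product B).map F).sum = (A.map fun a => (B.map fun b => F (a, b)).sum).sum := by
  induction A with
  | nil => simp [List.product]
  | cons a A ih =>
    simp only [List.product, List.flatMap_cons, List.map_append, List.sum_append, List.map_cons,
      List.sum_cons, List.map_map, Function.comp_def] at ih ⊢
    rw [ih]

/-- Multiplicities in a merged list are a truncated convolution. -/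
theorem mult_merge (A B : List (Entry n)) (τ : ℝ) {S : Finset ℤ} (h : ∀ e ∈ A, e.value ∈ S)
    (x : ℤ) : mult (merge A B τ) x =
      if |(x : ℝ)| ≤ τ then ∑ a ∈ S, mult A a * mult B (x - a) else 0 := by
  rw [mult, merge, sum_map_filter, List.map_map, sum_map_product]
  simp only [Function.comp_def, Entry.combine]
  split_ifs with hx
  · rw [← sum_map_value A h fun a => mult B (x - a)]
    congr 1
    refine List.map_congr_left fun a _ => ?_
    rw [mult]
    congr 1
    refine List.map_congr_left fun b _ => ?_
    by_cases hab : a.value + b.value = x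
    · have : b.value = x - a.value := by omega
      simp [this, hx]
    · have : b.value ≠ x - a.value := by omega
      simp [hab, this]
  · refine List.sum_eq_zero fun y hy => ?_
    obtain ⟨a, -, rfl⟩ := List.mem_map.1 hy
    refine List.sum_eq_zero fun y hy => ?_
    obtain ⟨b, -, rfl⟩ := List.mem_map.1 hy
    by_cases hab : a.value + b.value = x
    · simp only [hab, hx, if_false]
    · simp [hab]

end Multiplicity

/-! ### Structure of the lists -/

/-- The largest integer allowed in round `d`. -/
noncomputable def bound (m : ℕ) (p : ℝ) (d : ℕ) : ℤ := ⌊p ^ d * ((m : ℝ) / 2)⌋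

/-- The integers allowed in round `d`. -/
noncomputable def window (m : ℕ) (p : ℝ) (d : ℕ) : Finset ℤ :=
  Finset.Icc (-bound m p d) (bound m p d)

/-- The number of integers allowed in round `d`, as a real number. -/
noncomputable def width (m : ℕ) (p : ℝ) (d : ℕ) : ℝ := (window m p d).card

theorem abs_le_iff_mem_window {m : ℕ} {p : ℝ} {d : ℕ} {x : ℤ} :
    |(x : ℝ)| ≤ p ^ d * ((m : ℝ) / 2) ↔ x ∈ window m p d := by
  rw [window, Finset.mem_Icc, ← abs_le, bound, Int.le_floor, Int.cast_abs]

theorem window_zero (m : ℕ) (p : ℝ) : window m p 0 = range m := by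
  have : bound m p 0 = (m : ℤ) / 2 := by
    have h1 : (2 : ℤ) * ((m : ℤ) / 2) ≤ m := by omega
    have h2 : (m : ℤ) < 2 * ((m : ℤ) / 2) + 2 := by omega
    have h3 : (2 : ℝ) * (((m : ℤ) / 2 : ℤ) : ℝ) ≤ m := by exact_mod_cast h1
    have h4 : (m : ℝ) < 2 * (((m : ℤ) / 2 : ℤ) : ℝ) + 2 := by exact_mod_cast h2
    rw [bound, Int.floor_eq_iff, pow_zero, one_mul]
    constructor <;> linarith
  rw [window, this, range]

section Lists

variable {k n m : ℕ} {p : ℝ}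

theorem value_mem_window {L : Fin k → Fin n → ℤ} (hL : ∀ i j, L i j ∈ range m) (d i : ℕ) :
    ∀ e ∈ lists m p L d i, e.value ∈ window m p d := by
  cases d with
  | zero =>
    intro e he
    rw [lists] at he
    split_ifs at he with h
    · obtain ⟨j, -, rfl⟩ := List.mem_map.1 he
      rw [window_zero]
      exact hL _ _
    · simp at he
  | succ d =>
    intro e he
    rw [lists, merge, List.mem_filter] at he
    rw [← abs_le_iff_mem_window]
    simpa using he.2

/-- The list with number `i` in round `d` depends only on the `i`-th block of `2 ^ d` inputs. -/
theorem lists_congr {L L' : Fin k → Fin n → ℤ} {d i : ℕ}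
    (h : ∀ r : Fin k, (r : ℕ) / 2 ^ d = i → L r = L' r) : lists m p L d i = lists m p L' d i := by
  induction d generalizing i with
  | zero =>
    simp only [lists]
    split_ifs with hi
    · rw [h ⟨i, hi⟩ (by simp)]
    · rfl
  | succ d ih =>
    have h2 : ∀ r : Fin k, ∀ b, b < 2 → (r : ℕ) / 2 ^ d = 2 * i + b → L r = L' r := by
      intro r b hb hr
      refine h r ?_
      rw [pow_succ, ← Nat.div_div_eq_div_mul, hr]
      omega
    simp only [lists]
    rw [ih fun r hr => h2 r 0 (by norm_num) (by simpa using hr),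
      ih fun r hr => h2 r 1 (by norm_num) hr]

/-- Every entry carries positions that produce its value: for each input list in its block, one
position. -/
theorem exists_positions (L : Fin k → Fin n → ℤ) (d i : ℕ) (hi : (i + 1) * 2 ^ d ≤ k) :
    ∀ e ∈ lists m p L d i, ∃ l : Fin (2 ^ d) → Fin n, e.indices = List.ofFn l ∧
      ∃ v : Fin (2 ^ d) → Fin k, (∀ r, (v r : ℕ) = i * 2 ^ d + r) ∧
        e.value = ∑ r, L (v r) (l r) := by
  induction d generalizing i with
  | zero =>
    intro e he
    have hi' : i < k := by simpa using hi
    rw [lists, dif_pos hi'] at he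
    obtain ⟨j, -, rfl⟩ := List.mem_map.1 he
    exact ⟨fun _ => j, by simp, fun _ => ⟨i, hi'⟩, fun r => by simp, by simp⟩
  | succ d ih =>
    intro e he
    rw [lists, merge, List.mem_filter] at he
    obtain ⟨⟨a, b⟩, hab, rfl⟩ := List.mem_map.1 he.1
    obtain ⟨ha, hb⟩ := List.mem_product.1 hab
    rw [pow_succ] at hi
    obtain ⟨l₁, hl₁, v₁, hv₁, e₁⟩ := ih (2 * i) (by nlinarith) a ha
    obtain ⟨l₂, hl₂, v₂, hv₂, e₂⟩ := ih (2 * i + 1) (by nlinarith) b hb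
    have hpow : 2 ^ (d + 1) = 2 ^ d + 2 ^ d := by ring
    refine ⟨fun r => Fin.append l₁ l₂ (r.cast hpow), ?_,
      fun r => Fin.append v₁ v₂ (r.cast hpow), ?_, ?_⟩
    · have h1 : ∀ (N : ℕ) (hN : N = 2 ^ d + 2 ^ d),
          List.ofFn (fun r : Fin N => Fin.append l₁ l₂ (r.cast hN)) =
            List.ofFn l₁ ++ List.ofFn l₂ := by
        rintro N rfl
        rw [← List.ofFn_fin_append]
        rfl
      rw [h1 _ hpow, Entry.combine, hl₁, hl₂]
    · intro r
      obtain ⟨s, rfl⟩ := (finCongr hpow).symm.surjective r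
      refine Fin.addCases (fun s => ?_) (fun s => ?_) s
      · simp [hv₁]
        ring
      · simp [hv₂, -Fin.natAdd_eq_addNat]
        ring
    · rw [← (finCongr hpow).symm.sum_comp]
      simp [Fin.sum_univ_add, Entry.combine, e₁, e₂, -Fin.natAdd_eq_addNat]

/-- For `k` a power of two the algorithm succeeds exactly if `0` occurs in the last list. -/
theorem succeeds_iff {t : ℕ} (hk : k = 2 ^ t) (L : Fin k → Fin n → ℤ) :
    Succeeds m p L ↔ ∃ e ∈ lists m p L t 0, e.value = 0 := by
  subst hk
  constructor
  · rintro ⟨l, hl, -⟩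
    rw [output, Nat.log_pow Nat.one_lt_two, Option.map_eq_some_iff] at hl
    obtain ⟨e, he, -⟩ := hl
    exact ⟨e, List.mem_of_find?_eq_some he, by simpa using List.find?_some he⟩
  · rintro ⟨e, he, h0⟩
    obtain ⟨e', he'⟩ := Option.isSome_iff_exists.1
      (List.find?_isSome.2 ⟨e, he, by simpa using h0⟩ :
        ((lists m p L t 0).find? fun e => decide (e.value = 0)).isSome)
    have h0' : e'.value = 0 := by simpa using List.find?_some he'
    obtain ⟨l, hl, v, hv, hs⟩ := exists_positions L t 0 (by simp) e' (List.mem_of_find?_eq_some he')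
    have hv' : ∀ r, v r = r := fun r => Fin.ext (by simp [hv])
    refine ⟨l, ?_, ?_⟩
    · rw [output, Nat.log_pow Nat.one_lt_two, he', Option.map_some, hl]
    · simpa [hv', h0'] using hs.symm

end Lists

/-! ### First and second moments of the multiplicities -/

section Moments

variable {k n m : ℕ} {p : ℝ}

/-- The multiplicity of `x` in the list with number `i` of round `d`, as a function of the input. -/
noncomputable def cnt (p : ℝ) (d i : ℕ) (x : ℤ) (L : Fin k → Fin n → range m) : ℝ :=
  mult (lists m p (fun r j => (L r j : ℤ)) d i) x

/-- The expected multiplicity of a value in round `d`, ignoring boundary effects: a value of round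
`d + 1` arises from `width m p d` pairs of values of round `d`. -/
noncomputable def peak (n m : ℕ) (p : ℝ) : ℕ → ℝ
  | 0 => n / width m p 0
  | d + 1 => peak n m p d ^ 2 * width m p d

theorem width_nonneg (m : ℕ) (p : ℝ) (d : ℕ) : 0 ≤ width m p d := Nat.cast_nonneg _

theorem peak_nonneg (n m : ℕ) (p : ℝ) (d : ℕ) : 0 ≤ peak n m p d := by
  cases d with
  | zero => exact div_nonneg (Nat.cast_nonneg _) (width_nonneg _ _ _)
  | succ d => exact mul_nonneg (sq_nonneg _) (width_nonneg _ _ _)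

theorem range_nonempty (m : ℕ) : (range m).Nonempty :=
  ⟨0, by rw [range, Finset.mem_Icc]; omega⟩

instance (m : ℕ) : Nonempty (range m) := (range_nonempty m).to_subtype

theorem cnt_nonneg (d i : ℕ) (x : ℤ) (L : Fin k → Fin n → range m) : 0 ≤ cnt p d i x L :=
  mult_nonneg _ _

theorem cnt_eq_zero {d i : ℕ} {x : ℤ} (hx : x ∉ window m p d) (L : Fin k → Fin n → range m) :
    cnt p d i x L = 0 :=
  mult_eq_zero fun _ he h => hx (h ▸ value_mem_window (fun r j => (L r j).2) d i _ he)

theorem cnt_succ {d : ℕ} (i : ℕ) {x : ℤ} (hx : x ∈ window m p (d + 1))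
    (L : Fin k → Fin n → range m) : cnt p (d + 1) i x L =
      ∑ a ∈ window m p d, cnt p d (2 * i) a L * cnt p d (2 * i + 1) (x - a) L := by
  rw [cnt, lists, mult_merge _ _ _ (value_mem_window (fun r j => (L r j).2) d (2 * i)),
    if_pos (abs_le_iff_mem_window.2 hx)]
  rfl

theorem cnt_zero {i : ℕ} (hi : i < k) (x : ℤ) (L : Fin k → Fin n → range m) :
    cnt p 0 i x L = ∑ j, if (L ⟨i, hi⟩ j : ℤ) = x then (1 : ℝ) else 0 := by
  rw [cnt, lists, dif_pos hi, mult, List.map_map, Fin.sum_univ_def]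
  rfl

theorem cnt_zero_of_le {i : ℕ} (hi : k ≤ i) (x : ℤ) (L : Fin k → Fin n → range m) :
    cnt p 0 i x L = 0 := by
  rw [cnt, lists, dif_neg (by omega)]
  simp [mult]

theorem dependsOn_cnt (d i : ℕ) (x : ℤ) :
    DependsOn (cnt (k := k) (n := n) (m := m) p d i x) {r | (r : ℕ) / 2 ^ d = i} := by
  intro L L' h
  rw [cnt, cnt, lists_congr fun r hr => ?_]
  rw [h r hr]

/-- Multiplicities in the two lists merged into one are independent. -/
theorem expect_cnt_mul {d i : ℕ} {f g : (Fin k → Fin n → range m) → ℝ}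
    (hf : DependsOn f {r : Fin k | (r : ℕ) / 2 ^ d = 2 * i})
    (hg : DependsOn g {r : Fin k | (r : ℕ) / 2 ^ d = 2 * i + 1}) :
    𝔼 L, f L * g L = (𝔼 L, f L) * 𝔼 L, g L :=
  expect_mul_of_dependsOn hf <| hg.mono fun r (hr : _ = _) (hr' : _ = _) => by omega

theorem dependsOn_cnt_mul (d i : ℕ) (x y : ℤ) :
    DependsOn (fun L => cnt (k := k) (n := n) (m := m) p d i x L * cnt p d i y L)
      {r | (r : ℕ) / 2 ^ d = i} := fun L L' h => by
  simp only [dependsOn_cnt d i x h, dependsOn_cnt d i y h]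

theorem expect_cnt_succ {d : ℕ} (i : ℕ) {x : ℤ} (hx : x ∈ window m p (d + 1)) :
    𝔼 L : Fin k → Fin n → range m, cnt p (d + 1) i x L =
      ∑ a ∈ window m p d, (𝔼 L : Fin k → Fin n → range m, cnt p d (2 * i) a L) *
        𝔼 L : Fin k → Fin n → range m, cnt p d (2 * i + 1) (x - a) L := by
  simp only [cnt_succ i hx]
  rw [Finset.expect_sum_comm]
  exact Finset.sum_congr rfl fun a _ => expect_cnt_mul (dependsOn_cnt _ _ _) (dependsOn_cnt _ _ _)

theorem expect_cnt_mul_cnt_succ {d : ℕ} (i : ℕ) {x y : ℤ} (hx : x ∈ window m p (d + 1))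
    (hy : y ∈ window m p (d + 1)) :
    𝔼 L : Fin k → Fin n → range m, cnt p (d + 1) i x L * cnt p (d + 1) i y L =
      ∑ a ∈ window m p d, ∑ b ∈ window m p d,
        (𝔼 L : Fin k → Fin n → range m, cnt p d (2 * i) a L * cnt p d (2 * i) b L) *
        𝔼 L : Fin k → Fin n → range m,
          cnt p d (2 * i + 1) (x - a) L * cnt p d (2 * i + 1) (y - b) L := by
  simp only [cnt_succ i hx, cnt_succ i hy, Finset.sum_mul_sum]
  rw [Finset.expect_sum_comm]
  refine Finset.sum_congr rfl fun a _ => ?_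
  rw [Finset.expect_sum_comm]
  refine Finset.sum_congr rfl fun b _ => ?_
  rw [← expect_cnt_mul (dependsOn_cnt_mul _ _ _ _) (dependsOn_cnt_mul _ _ _ _)]
  exact Finset.expect_congr rfl fun L _ => by ring

theorem width_zero (m : ℕ) (p : ℝ) : width m p 0 = Fintype.card (range m) := by
  rw [width, window_zero, Fintype.card_coe]

/-- A uniform element of `range m` equals `x` with probability at most `1 / width m p 0`, with
equality for `x` in the range. -/
theorem expect_eq_le (m : ℕ) (p : ℝ) (x : ℤ) :
    (𝔼 a : range m, if (a : ℤ) = x then (1 : ℝ) else 0) ≤ 1 / width m p 0 ∧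
      (x ∈ window m p 0 →
        (𝔼 a : range m, if (a : ℤ) = x then (1 : ℝ) else 0) = 1 / width m p 0) := by
  have key : x ∈ window m p 0 →
      (𝔼 a : range m, if (a : ℤ) = x then (1 : ℝ) else 0) = 1 / width m p 0 := by
    intro hx
    rw [window_zero] at hx
    rw [Fintype.expect_eq_sum_div_card, width_zero]
    congr 1
    rw [Finset.sum_eq_single ⟨x, hx⟩] <;> simp +contextual [Subtype.ext_iff]
  refine ⟨?_, key⟩
  by_cases hx : x ∈ window m p 0
  · exact (key hx).le
  · rw [Finset.expect_eq_zero]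
    · exact div_nonneg zero_le_one (width_nonneg _ _ _)
    · rintro ⟨a, ha⟩ -
      rw [window_zero] at hx
      exact if_neg fun h => hx (by simpa [← h] using ha)

theorem expect_cnt_zero {i : ℕ} (hi : i < k) (x : ℤ) :
    𝔼 L : Fin k → Fin n → range m, cnt p 0 i x L =
      n * 𝔼 a : range m, if (a : ℤ) = x then (1 : ℝ) else 0 := by
  simp only [cnt_zero hi]
  rw [expect_apply (⟨i, hi⟩ : Fin k)
    (fun l : Fin n → range m => ∑ j, if (l j : ℤ) = x then (1 : ℝ) else 0),
    Finset.expect_sum_comm,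
    Finset.sum_congr rfl fun j _ => expect_apply j
      (fun a : range m => if (a : ℤ) = x then (1 : ℝ) else 0)]
  simp

theorem expect_cnt_le (d i : ℕ) (x : ℤ) :
    𝔼 L : Fin k → Fin n → range m, cnt p d i x L ≤ peak n m p d := by
  induction d generalizing i x with
  | zero =>
    rcases lt_or_ge i k with hi | hi
    · rw [expect_cnt_zero hi, peak, div_eq_mul_one_div]
      exact mul_le_mul_of_nonneg_left (expect_eq_le m p x).1 (Nat.cast_nonneg _)
    · rw [Finset.expect_eq_zero fun L _ => cnt_zero_of_le hi x L]
      exact peak_nonneg _ _ _ _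
  | succ d ih =>
    by_cases hx : x ∈ window m p (d + 1)
    · rw [expect_cnt_succ i hx, peak]
      calc _ ≤ ∑ a ∈ window m p d, peak n m p d ^ 2 := by
            refine Finset.sum_le_sum fun a _ => ?_
            rw [sq]
            exact mul_le_mul (ih _ _) (ih _ _)
              (Finset.expect_nonneg fun L _ => cnt_nonneg _ _ _ _) (peak_nonneg _ _ _ _)
        _ = _ := by rw [Finset.sum_const, nsmul_eq_mul, mul_comm]; rfl
    · rw [Finset.expect_eq_zero fun L _ => cnt_eq_zero hx L]
      exact peak_nonneg _ _ _ _

/-- Boundary effect of a merge: of the elements `a` of a window, at most `|x|` fail to have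
`x - a` in the window too. -/
theorem card_filter_window {d : ℕ} {x : ℤ} {T : ℤ} (hT : |x| ≤ T) :
    width m p d - T ≤ ((window m p d).filter fun a => x - a ∈ window m p d).card := by
  have h : window m p d ⊆ ((window m p d).filter fun a => x - a ∈ window m p d) ∪
      (if 0 ≤ x then Finset.Ico (-bound m p d) (-bound m p d + x)
        else Finset.Ioc (bound m p d + x) (bound m p d)) := by
    intro a ha
    simp only [window, Finset.mem_Icc, Finset.mem_union, Finset.mem_filter] at ha ⊢
    split_ifs with h0
    · rw [Finset.mem_Ico]; omega
    · rw [Finset.mem_Ioc]; omega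
  have h1 := (Finset.card_le_card h).trans (Finset.card_union_le _ _)
  have h2 : ((if 0 ≤ x then Finset.Ico (-bound m p d) (-bound m p d + x)
        else Finset.Ioc (bound m p d + x) (bound m p d)).card : ℤ) ≤ T := by
    rw [abs_le] at hT
    split_ifs with h0
    · rw [Int.card_Ico]; omega
    · rw [Int.card_Ioc]; omega
  have h3 : ((window m p d).card : ℤ) - T ≤
      ((window m p d).filter fun a => x - a ∈ window m p d).card := by omega
  rw [width]
  exact_mod_cast h3

theorem le_expect_cnt {ρ : ℝ} (h0 : 0 ≤ ρ) {d : ℕ} (i : ℕ)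
    (hi : (i + 1) * 2 ^ d ≤ k)
    (hρ : ∀ e < d, (bound m p (e + 1) : ℝ) ≤ (1 - ρ) * width m p e) {x : ℤ}
    (hx : x ∈ window m p d) :
    peak n m p d * ρ ^ (2 ^ d - 1) ≤ 𝔼 L : Fin k → Fin n → range m, cnt p d i x L := by
  induction d generalizing i x with
  | zero =>
    have hi' : i < k := by simpa using hi
    rw [expect_cnt_zero hi', (expect_eq_le m p x).2 hx, peak]
    simp [div_eq_mul_inv]
  | succ d ih =>
    rw [pow_succ 2 d] at hi
    rw [expect_cnt_succ i hx]
    have hx' : |x| ≤ bound m p (d + 1) := by rwa [window, Finset.mem_Icc, ← abs_le] at hx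
    have hc := card_filter_window (m := m) (p := p) (d := d) hx'
    have hg := peak_nonneg n m p d
    set q := peak n m p d * ρ ^ (2 ^ d - 1) with hq
    have hq0 : 0 ≤ q := by positivity
    have hexp : 2 ^ (d + 1) - 1 = (2 ^ d - 1) + (2 ^ d - 1) + 1 := by
      have := Nat.one_le_two_pow (n := d)
      rw [pow_succ]; omega
    calc peak n m p (d + 1) * ρ ^ (2 ^ (d + 1) - 1)
        = (ρ * width m p d) * q ^ 2 := by
          rw [hexp, hq, peak]; ring
      _ ≤ ((window m p d).filter fun a => x - a ∈ window m p d).card * q ^ 2 := by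
          refine mul_le_mul_of_nonneg_right (le_trans ?_ hc) (sq_nonneg _)
          linarith [hρ d (Nat.lt_succ_self d)]
      _ = ∑ a ∈ (window m p d).filter (fun a => x - a ∈ window m p d), q ^ 2 := by
          rw [Finset.sum_const, nsmul_eq_mul]
      _ ≤ ∑ a ∈ (window m p d).filter (fun a => x - a ∈ window m p d),
          (𝔼 L : Fin k → Fin n → range m, cnt p d (2 * i) a L) *
            𝔼 L : Fin k → Fin n → range m, cnt p d (2 * i + 1) (x - a) L := by
          refine Finset.sum_le_sum fun a ha => ?_
          rw [Finset.mem_filter] at ha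
          have hρ' : ∀ e < d, (bound m p (e + 1) : ℝ) ≤ (1 - ρ) * width m p e :=
            fun e he => hρ e (he.trans (Nat.lt_succ_self d))
          rw [sq]
          exact mul_le_mul (ih (2 * i) (by nlinarith) hρ' ha.1)
            (ih (2 * i + 1) (by nlinarith) hρ' ha.2) hq0
            (Finset.expect_nonneg fun L _ => cnt_nonneg _ _ _ _)
      _ ≤ _ := Finset.sum_le_sum_of_subset_of_nonneg (Finset.filter_subset _ _) fun a _ _ =>
          mul_nonneg (Finset.expect_nonneg fun L _ => cnt_nonneg _ _ _ _)
            (Finset.expect_nonneg fun L _ => cnt_nonneg _ _ _ _)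

theorem expect_cnt_mul_cnt_zero_le {i : ℕ} (x y : ℤ) :
    𝔼 L : Fin k → Fin n → range m, cnt p 0 i x L * cnt p 0 i y L ≤
      peak n m p 0 ^ 2 + if x = y then peak n m p 0 else 0 := by
  have hite : (0 : ℝ) ≤ if x = y then peak n m p 0 else 0 := by
    split_ifs
    · exact peak_nonneg _ _ _ _
    · exact le_rfl
  rcases lt_or_ge i k with hi | hi
  swap
  · rw [Finset.expect_eq_zero fun L _ => by rw [cnt_zero_of_le hi, zero_mul]]
    positivity
  set w := 1 / width m p 0 with hw
  have hw0 : 0 ≤ w := div_nonneg zero_le_one (width_nonneg _ _ _)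
  have hnn : ∀ z : ℤ, (0 : ℝ) ≤ 𝔼 a : range m, if (a : ℤ) = z then (1 : ℝ) else 0 := fun z =>
    Finset.expect_nonneg fun a _ => by split_ifs <;> simp
  simp only [cnt_zero hi]
  rw [expect_apply (⟨i, hi⟩ : Fin k)
    (fun l : Fin n → range m => (∑ j, if (l j : ℤ) = x then (1 : ℝ) else 0) *
      ∑ j, if (l j : ℤ) = y then (1 : ℝ) else 0)]
  simp only [Finset.sum_mul_sum]
  rw [Finset.expect_sum_comm]
  have hterm : ∀ j j' : Fin n, (𝔼 l : Fin n → range m,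
      (if (l j : ℤ) = x then (1 : ℝ) else 0) * if (l j' : ℤ) = y then (1 : ℝ) else 0) ≤
        w ^ 2 + if j = j' then (if x = y then w else 0) else 0 := by
    intro j j'
    by_cases hj : j = j'
    · subst hj
      rw [expect_apply j (fun a : range m => (if (a : ℤ) = x then (1 : ℝ) else 0) *
        if (a : ℤ) = y then (1 : ℝ) else 0), if_pos rfl]
      by_cases hxy : x = y
      · subst hxy
        have := (expect_eq_le m p x).1
        simp only [mul_ite, mul_one, mul_zero, if_true]
        have h2 : ∀ a : range m, (if (a : ℤ) = x then if (a : ℤ) = x then (1 : ℝ) else 0 else 0) =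
            if (a : ℤ) = x then (1 : ℝ) else 0 := fun a => by split_ifs <;> rfl
        simp only [h2]
        nlinarith [sq_nonneg w]
      · rw [Finset.expect_eq_zero, if_neg hxy]
        · positivity
        · intro a _
          by_cases ha : (a : ℤ) = x
          · rw [if_neg (fun h => hxy (ha.symm.trans h)), mul_zero]
          · rw [if_neg ha, zero_mul]
    · rw [if_neg hj, add_zero, expect_mul_of_dependsOn (S := {j})
        (f := fun l : Fin n → range m => if (l j : ℤ) = x then (1 : ℝ) else 0)
        (g := fun l : Fin n → range m => if (l j' : ℤ) = y then (1 : ℝ) else 0)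
        (fun l l' h => by simp only [h j rfl])
        (fun l l' h => by simp only [h j' (Ne.symm hj)]),
        expect_apply j (fun a : range m => if (a : ℤ) = x then (1 : ℝ) else 0),
        expect_apply j' (fun a : range m => if (a : ℤ) = y then (1 : ℝ) else 0), sq]
      exact mul_le_mul (expect_eq_le m p x).1 (expect_eq_le m p y).1 (hnn y) hw0
  have hpeak : peak n m p 0 = n * w := by rw [peak, hw, div_eq_mul_one_div]
  calc _ ≤ ∑ j : Fin n, ∑ j' : Fin n,
        (w ^ 2 + if j = j' then (if x = y then w else 0) else 0) := by
        refine Finset.sum_le_sum fun j _ => ?_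
        rw [Finset.expect_sum_comm]
        exact Finset.sum_le_sum fun j' _ => hterm j j'
    _ = _ := by
        rw [hpeak]
        simp only [Finset.sum_add_distrib, Finset.sum_ite_eq, Finset.mem_univ, if_true,
          Finset.sum_const, Finset.card_univ, Fintype.card_fin, nsmul_eq_mul]
        split_ifs <;> ring

/-- The recursion for upper bounds on second moments. A pair of equal values contributes an extra
`B`; convolving the bound `A + B * 1[x = y]` with itself reproduces its shape. -/
theorem sum_sum_add_ite_le (S : Finset ℤ) {A B : ℝ} (hA : 0 ≤ A) (hB : 0 ≤ B) (x y : ℤ) :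
    ∑ a ∈ S, ∑ b ∈ S, (A + if a = b then B else 0) * (A + if x - a = y - b then B else 0) ≤
      A ^ 2 * S.card ^ 2 + 2 * A * B * S.card + if x = y then B ^ 2 * S.card else 0 := by
  have h : ∀ a ∈ S, ∑ b ∈ S, (A + if a = b then B else 0) * (A + if x - a = y - b then B else 0) ≤
      A ^ 2 * S.card + 2 * A * B + if x = y then B ^ 2 else 0 := by
    intro a ha
    have e : ∀ b, (A + if a = b then B else 0) * (A + if x - a = y - b then B else 0) =
        A ^ 2 + (if a = b then A * B else 0) + (if b = y - x + a then A * B else 0) +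
          if a = b then (if x = y then B ^ 2 else 0) else 0 := by
      intro b
      have h1 : x - a = y - b ↔ b = y - x + a := by omega
      by_cases hab : a = b
      · subst hab
        have h2 : a = y - x + a ↔ x = y := by omega
        simp only [h1, h2, if_true]
        split_ifs <;> ring
      · simp only [h1, hab, if_false]
        split_ifs <;> ring
    simp only [e, Finset.sum_add_distrib, Finset.sum_ite_eq, Finset.sum_ite_eq', ha, if_true,
      Finset.sum_const, nsmul_eq_mul]
    have : (if y - x + a ∈ S then A * B else 0) ≤ A * B := by
      split_ifs
      · exact le_rfl
      · positivity
    linarith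
  refine (Finset.sum_le_sum h).trans (le_of_eq ?_)
  rw [Finset.sum_const, nsmul_eq_mul]
  split_ifs <;> ring

/-- Second moment bound. The parameters `s` and `y` control the contribution of pairs of index
tuples that agree in some, but not all, positions. -/
theorem expect_cnt_mul_cnt_le {s y : ℝ} (hs : 0 ≤ s) (hy : 1 ≤ y) {d : ℕ} (i : ℕ)
    (h : ∀ e < d, 1 ≤ peak n m p e * width m p e * (s * y ^ 2 ^ e)) (x x' : ℤ) :
    𝔼 L : Fin k → Fin n → range m, cnt p d i x L * cnt p d i x' L ≤
      peak n m p d ^ 2 * (1 + ((1 + s) ^ (2 * (2 ^ d - 1)) - 1) * y ^ 2 ^ d) +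
        if x = x' then peak n m p d else 0 := by
  induction d generalizing i x x' with
  | zero => simpa using expect_cnt_mul_cnt_zero_le x x'
  | succ d ih =>
    have hδ : ∀ j, (1 : ℝ) ≤ (1 + s) ^ j := fun j => one_le_pow₀ (by linarith)
    have hP := peak_nonneg n m p d
    have hP' := peak_nonneg n m p (d + 1)
    have hY : 1 ≤ y ^ 2 ^ d := one_le_pow₀ hy
    by_cases hx : x ∈ window m p (d + 1) ∧ x' ∈ window m p (d + 1)
    swap
    · rw [Finset.expect_eq_zero]
      · have := hδ (2 * (2 ^ (d + 1) - 1))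
        have h3 : 0 ≤ (1 + s) ^ (2 * (2 ^ (d + 1) - 1)) - 1 := by linarith
        have h4 : (0 : ℝ) ≤ if x = x' then peak n m p (d + 1) else 0 := by
          split_ifs
          exacts [hP', le_rfl]
        have h5 : 0 ≤ y := by linarith
        positivity
      · intro L _
        by_cases h1 : x ∈ window m p (d + 1)
        · rw [cnt_eq_zero (fun h2 => hx ⟨h1, h2⟩), mul_zero]
        · rw [cnt_eq_zero h1, zero_mul]
    rw [expect_cnt_mul_cnt_succ i hx.1 hx.2]
    have hw := width_nonneg m p d
    have hd := h d (Nat.lt_succ_self d)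
    set P := peak n m p d
    set W := width m p d
    set Y := y ^ 2 ^ d
    set v := (1 + s) ^ (2 * (2 ^ d - 1)) with hv
    have hv1 : 1 ≤ v := hδ _
    set U := 1 + (v - 1) * Y with hU
    have hU1 : 1 ≤ U := by nlinarith
    have ih' := fun i x x' => ih i (fun e he => h e (he.trans (Nat.lt_succ_self d))) x x'
    calc _ ≤ ∑ a ∈ window m p d, ∑ b ∈ window m p d,
          (P ^ 2 * U + if a = b then P else 0) *
            (P ^ 2 * U + if x - a = x' - b then P else 0) := by
          refine Finset.sum_le_sum fun a _ => Finset.sum_le_sum fun b _ => ?_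
          refine mul_le_mul (ih' _ _ _) (ih' _ _ _)
            (Finset.expect_nonneg fun L _ => mul_nonneg (cnt_nonneg _ _ _ _) (cnt_nonneg _ _ _ _)) ?_
          have : (0 : ℝ) ≤ if a = b then P else 0 := by
            split_ifs
            exacts [hP, le_rfl]
          positivity
      _ ≤ (P ^ 2 * U) ^ 2 * W ^ 2 + 2 * (P ^ 2 * U) * P * W + if x = x' then P ^ 2 * W else 0 :=
          sum_sum_add_ite_le _ (by positivity) hP x x'
      _ ≤ (P ^ 2 * W) ^ 2 * (U ^ 2 + 2 * U * (s * Y)) + if x = x' then P ^ 2 * W else 0 := by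
          have : 2 * (P ^ 2 * U) * P * W * 1 ≤ 2 * (P ^ 2 * U) * P * W * (P * W * (s * Y)) :=
            mul_le_mul_of_nonneg_left hd (by positivity)
          nlinarith
      _ ≤ (P ^ 2 * W) ^ 2 * (1 + ((v * (1 + s)) ^ 2 - 1) * Y ^ 2) +
            if x = x' then P ^ 2 * W else 0 := by
          have h1 : U ^ 2 + 2 * U * (s * Y) ≤ 1 + ((v * (1 + s)) ^ 2 - 1) * Y ^ 2 := by
            have h2 : U ^ 2 + 2 * U * (s * Y) ≤ (1 + (v - 1 + s) * Y) ^ 2 := by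
              nlinarith [sq_nonneg (s * Y)]
            have h3 : (v - 1 + s) * Y ≤ (v - 1 + s) * Y ^ 2 := by
              refine mul_le_mul_of_nonneg_left ?_ (by linarith)
              nlinarith
            have h4 : (v + s) ^ 2 ≤ (v * (1 + s)) ^ 2 := by
              refine pow_le_pow_left₀ (by linarith) ?_ 2
              nlinarith
            have h5 : (v + s) ^ 2 * Y ^ 2 ≤ (v * (1 + s)) ^ 2 * Y ^ 2 :=
              mul_le_mul_of_nonneg_right h4 (sq_nonneg _)
            nlinarith
          gcongr
      _ = _ := by
          have hexp : 2 * (2 ^ (d + 1) - 1) = (2 * (2 ^ d - 1)) * 2 + 2 := by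
            have := Nat.one_le_two_pow (n := d)
            rw [pow_succ]; omega
          have h6 : (v * (1 + s)) ^ 2 = (1 + s) ^ (2 * (2 ^ (d + 1) - 1)) := by
            rw [hexp, hv]; ring
          have h7 : Y ^ 2 = y ^ 2 ^ (d + 1) := by rw [pow_succ 2 d, pow_mul]
          rw [h6, h7]
          rfl

end Moments

/-! ### The success probability and the complexity as averages -/

section Law

variable {k n m : ℕ} {p : ℝ}

theorem integral_inputLaw (f : (Fin k → Fin n → range m) → ℝ) :
    ∫ L, f L ∂(inputLaw k n m) = 𝔼 L, f L := by
  have : MeasureTheory.IsProbabilityMeasure (inputLaw k n m) :=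
    ProbabilityTheory.isProbabilityMeasure_uniformOn Set.finite_univ Set.univ_nonempty
  rw [MeasureTheory.integral_fintype .of_finite, Fintype.expect_eq_sum_div_card, Finset.sum_div]
  refine Finset.sum_congr rfl fun L _ => ?_
  have h : (inputLaw k n m).real {L} = 1 / (Fintype.card (Fin k → Fin n → range m) : ℝ) := by
    rw [MeasureTheory.measureReal_def, inputLaw, ProbabilityTheory.uniformOn_univ]
    simp
  rw [h, smul_eq_mul]
  ring

open scoped Classical in
theorem successProb_eq {t : ℕ} (hk : k = 2 ^ t) :
    successProb k n m p = 𝔼 L : Fin k → Fin n → range m,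
      if L ∈ {L | ∃ e ∈ lists m p (fun r j => (L r j : ℤ)) t 0, e.value = 0} then (1 : ℝ)
        else 0 := by
  rw [successProb, ← integral_inputLaw,
    ← MeasureTheory.integral_indicator_one (Set.toFinite _).measurableSet]
  congr 1
  ext L
  simp [Set.indicator_apply, succeeds_iff hk]

theorem successProb_le {t : ℕ} (hk : k = 2 ^ t) : successProb k n m p ≤ peak n m p t := by
  classical
  rw [successProb_eq hk]
  refine le_trans (Finset.expect_le_expect fun L _ => ?_)
    (expect_cnt_le (k := k) (n := n) (m := m) (p := p) t 0 0)
  split_ifs with h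
  · obtain ⟨e, he, h0⟩ := h
    have := one_le_mult he
    rwa [h0] at this
  · exact cnt_nonneg _ _ _ _

theorem sq_expect_cnt_le {t : ℕ} (hk : k = 2 ^ t) :
    (𝔼 L : Fin k → Fin n → range m, cnt p t 0 0 L) ^ 2 ≤
      (𝔼 L : Fin k → Fin n → range m, cnt p t 0 0 L * cnt p t 0 0 L) *
        successProb k n m p := by
  classical
  rw [successProb_eq hk]
  simp only [← sq]
  exact sq_expect_le _ _ fun L hL => mult_eq_zero fun e he h0 => hL ⟨e, he, h0⟩

theorem complexity_eq {t : ℕ} (hk : k = 2 ^ t) :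
    complexity k n m p = ∑ d ∈ Finset.range (t + 1), ∑ i ∈ Finset.range (k / 2 ^ d),
      ∑ x ∈ window m p d, 𝔼 L : Fin k → Fin n → range m, cnt p d i x L := by
  have hlog : Nat.log 2 k = t := by rw [hk, Nat.log_pow Nat.one_lt_two]
  rw [complexity, integral_inputLaw]
  simp only [totalSize, hlog, Nat.cast_sum]
  rw [Finset.expect_sum_comm]
  refine Finset.sum_congr rfl fun d _ => ?_
  rw [Finset.expect_sum_comm]
  refine Finset.sum_congr rfl fun i _ => ?_
  rw [← Finset.expect_sum_comm]
  exact Finset.expect_congr rfl fun L _ =>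
    length_eq_sum_mult _ (value_mem_window (fun r j => (L r j).2) d i)

end Law

/-! ### Estimates of the windows -/

section Estimates

variable {k n m t : ℕ} {p : ℝ}

/-- While `p ^ d * m ≥ 1 / p`, rounding changes the size of a window by a factor `1 ± p` only. -/
theorem width_bounds (hp0 : 0 < p) (hp1 : p ≤ 1 / 2) (hm : p ^ (t + 1) * m = 1) {d : ℕ}
    (hd : d ≤ t) : (1 - p) * (p ^ d * m) ≤ width m p d ∧
      width m p d ≤ (1 + p) * (p ^ d * m) := by
  have hq : 1 ≤ p * (p ^ d * m) := by
    rw [← hm, ← mul_assoc, ← pow_succ']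
    exact mul_le_mul_of_nonneg_right
      (pow_le_pow_of_le_one hp0.le (by linarith) (by omega)) (Nat.cast_nonneg _)
  have hb0 : 0 ≤ bound m p d := Int.floor_nonneg.2 (by positivity)
  have hw : width m p d = 2 * bound m p d + 1 := by
    have h1 : ((window m p d).card : ℤ) = 2 * bound m p d + 1 := by
      rw [window, Int.card_Icc]; omega
    rw [width]
    exact_mod_cast h1
  have h1 : (bound m p d : ℝ) ≤ p ^ d * ((m : ℝ) / 2) := Int.floor_le _
  have h2 : p ^ d * ((m : ℝ) / 2) < bound m p d + 1 := Int.lt_floor_add_one _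
  constructor <;> linarith

theorem width_succ_bounds (hp0 : 0 < p) (hp1 : p ≤ 1 / 2) (hm : p ^ (t + 1) * m = 1) {d : ℕ}
    (hd : d < t) : width m p (d + 1) ≤ (1 + 4 * p) * (p * width m p d) ∧
      p * width m p d ≤ (1 + 4 * p) * width m p (d + 1) := by
  obtain ⟨h1, h2⟩ := width_bounds hp0 hp1 hm hd.le
  obtain ⟨h3, h4⟩ := width_bounds hp0 hp1 hm (Nat.succ_le_of_lt hd)
  have hs : p ^ (d + 1) * m = p * (p ^ d * m) := by rw [pow_succ]; ring
  rw [Nat.succ_eq_add_one, hs] at h3 h4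
  have hR : 1 + p ≤ (1 + 4 * p) * (1 - p) := by nlinarith
  have hq : 0 ≤ p * (p ^ d * (m : ℝ)) := by positivity
  have hR' := mul_le_mul_of_nonneg_right hR hq
  constructor
  · calc _ ≤ _ := h4
      _ ≤ _ := hR'
      _ = (1 + 4 * p) * (p * ((1 - p) * (p ^ d * m))) := by ring
      _ ≤ _ := by gcongr
  · calc p * width m p d ≤ p * ((1 + p) * (p ^ d * m)) := by gcongr
      _ = (1 + p) * (p * (p ^ d * m)) := by ring
      _ ≤ _ := hR'
      _ = (1 + 4 * p) * ((1 - p) * (p * (p ^ d * m))) := by ring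
      _ ≤ _ := by gcongr

theorem bound_succ_le (hp0 : 0 < p) (hp1 : p ≤ 1 / 2) (hm : p ^ (t + 1) * m = 1) {d : ℕ}
    (hd : d < t) : (bound m p (d + 1) : ℝ) ≤ p * width m p d := by
  have h1 := (width_bounds hp0 hp1 hm hd.le).1
  have h2 : (bound m p (d + 1) : ℝ) ≤ p ^ (d + 1) * ((m : ℝ) / 2) := Int.floor_le _
  have hq : 0 ≤ p ^ d * (m : ℝ) := by positivity
  calc _ ≤ _ := h2
    _ = p * (1 / 2 * (p ^ d * m)) := by rw [pow_succ]; ring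
    _ ≤ p * ((1 - p) * (p ^ d * m)) := by gcongr; linarith
    _ ≤ _ := by gcongr

/-- The expected length `peak * width` of a list in round `d` is `(p * n) ^ 2 ^ d / p`, up to a
factor `1 + 4 * p` for each merge. -/
theorem peak_mul_width_bounds (hp0 : 0 < p) (hp1 : p ≤ 1 / 2) (hm : p ^ (t + 1) * m = 1) {d : ℕ}
    (hd : d ≤ t) :
    (p * n) ^ 2 ^ d ≤ p * (peak n m p d * width m p d) * (1 + 4 * p) ^ (2 ^ d - 1) ∧
      p * (peak n m p d * width m p d) ≤ (p * n) ^ 2 ^ d * (1 + 4 * p) ^ (2 ^ d - 1) := by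
  induction d with
  | zero =>
    have hne : width m p 0 ≠ 0 := by
      rw [width_zero]
      exact_mod_cast Fintype.card_ne_zero
    simp [peak, hne]
  | succ d ih =>
    obtain ⟨h1, h2⟩ := ih (by omega)
    obtain ⟨h3, h4⟩ := width_succ_bounds hp0 hp1 hm hd
    have hP := peak_nonneg n m p d
    have hW := width_nonneg m p d
    have hexp : 2 ^ (d + 1) - 1 = (2 ^ d - 1) * 2 + 1 := by
      have := Nat.one_le_two_pow (n := d)
      rw [pow_succ]; omega
    rw [hexp, pow_succ _ ((2 ^ d - 1) * 2), pow_mul _ (2 ^ d - 1), pow_succ 2 d,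
      pow_mul _ (2 ^ d) 2, peak]
    set Q := (1 + 4 * p) ^ (2 ^ d - 1)
    have hQ : 0 ≤ Q := by positivity
    constructor
    · calc ((p * n) ^ 2 ^ d) ^ 2 ≤ (p * (peak n m p d * width m p d) * Q) ^ 2 := by gcongr
        _ = p * (peak n m p d ^ 2 * width m p d) * Q ^ 2 * (p * width m p d) := by ring
        _ ≤ p * (peak n m p d ^ 2 * width m p d) * Q ^ 2 *
            ((1 + 4 * p) * width m p (d + 1)) := by gcongr
        _ = _ := by ring
    · calc p * (peak n m p d ^ 2 * width m p d * width m p (d + 1))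
          ≤ p * (peak n m p d ^ 2 * width m p d * ((1 + 4 * p) * (p * width m p d))) := by gcongr
        _ = (p * (peak n m p d * width m p d)) ^ 2 * (1 + 4 * p) := by ring
        _ ≤ ((p * n) ^ 2 ^ d * Q) ^ 2 * (1 + 4 * p) := by gcongr
        _ = _ := by ring

/-- The expected number of zeros in the last list is `(p * n) ^ k`, up to a factor
`(1 + 4 * p) ^ k`. -/
theorem peak_bounds (hp0 : 0 < p) (hp1 : p ≤ 1 / 2) (hm : p ^ (t + 1) * m = 1) :
    (p * n) ^ 2 ^ t ≤ peak n m p t * (1 + 4 * p) ^ 2 ^ t ∧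
      peak n m p t ≤ (p * n) ^ 2 ^ t * (1 + 4 * p) ^ 2 ^ t := by
  obtain ⟨h1, h2⟩ := peak_mul_width_bounds (n := n) hp0 hp1 hm le_rfl
  obtain ⟨h3, h4⟩ := width_bounds hp0 hp1 hm le_rfl
  have hP := peak_nonneg n m p t
  have hq : p * (p ^ t * m) = 1 := by rw [← hm, pow_succ]; ring
  have hR : 1 + p ≤ (1 + 4 * p) * (1 - p) := by nlinarith
  have h5 : p * width m p t ≤ 1 + 4 * p := by
    calc _ ≤ p * ((1 + p) * (p ^ t * m)) := by gcongr
      _ = 1 + p := by rw [mul_left_comm, hq, mul_one]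
      _ ≤ _ := by linarith
  have h6 : 1 ≤ (1 + 4 * p) * (p * width m p t) := by
    calc (1 : ℝ) ≤ (1 + 4 * p) * (1 - p) := by linarith
      _ = (1 + 4 * p) * (p * ((1 - p) * (p ^ t * m))) := by rw [mul_left_comm p, hq, mul_one]
      _ ≤ _ := by gcongr
  have hQ : (1 + 4 * p) ^ 2 ^ t = (1 + 4 * p) ^ (2 ^ t - 1) * (1 + 4 * p) := by
    rw [← pow_succ, Nat.sub_add_cancel Nat.one_le_two_pow]
  rw [hQ]
  constructor
  · calc _ ≤ _ := h1
      _ = peak n m p t * ((1 + 4 * p) ^ (2 ^ t - 1) * (p * width m p t)) := by ring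
      _ ≤ _ := by gcongr
  · calc peak n m p t ≤ peak n m p t * ((1 + 4 * p) * (p * width m p t)) :=
          le_mul_of_one_le_right hP h6
      _ = p * (peak n m p t * width m p t) * (1 + 4 * p) := by ring
      _ ≤ (p * n) ^ 2 ^ t * (1 + 4 * p) ^ (2 ^ t - 1) * (1 + 4 * p) := by gcongr
      _ = _ := by ring

/-! ### Bounds for fixed parameters -/

/-- Second moment lower bound for the success probability, with the error in explicit form. -/
theorem le_successProb (hk : k = 2 ^ t) (hn : 0 < n) (hp0 : 0 < p) (hp1 : p ≤ 1 / 2)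
    (hm : p ^ (t + 1) * m = 1) :
    (p * n) ^ k / (1 + (p * n) ^ k) * (((1 - p) ^ k) ^ 2 / ((1 + 4 * p) ^ k *
      (1 + ((1 + p * (1 + 4 * p) ^ k) ^ (2 * k) - 1) * (1 + 4 * p) ^ k))) ≤
        successProb k n m p := by
  have hn' : (0 : ℝ) < n := Nat.cast_pos.2 hn
  set c := p * n with hc
  have hc0 : 0 < c := by positivity
  have hR1 : (1 : ℝ) ≤ 1 + 4 * p := by linarith
  set Q := (1 + 4 * p) ^ k with hQ
  have hQ1 : 1 ≤ Q := one_le_pow₀ hR1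
  set s := p * Q with hs
  have hs0 : 0 ≤ s := by positivity
  set δ := (1 + s) ^ (2 * k) - 1 with hδ
  have hδ0 : 0 ≤ δ := by
    have : 1 ≤ (1 + s) ^ (2 * k) := one_le_pow₀ (by linarith)
    linarith
  set P := peak n m p t with hP
  obtain ⟨hP1, hP2⟩ := peak_bounds (n := n) hp0 hp1 hm
  rw [← hk, ← hc, ← hQ, ← hP] at hP1 hP2
  have hck : 0 < c ^ k := by positivity
  have hP0 : 0 < P := by
    by_contra h
    have : P * Q ≤ 0 := mul_nonpos_of_nonpos_of_nonneg (not_lt.1 h) (by linarith)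
    linarith
  -- Lower bound on the first moment.
  have hwin : (0 : ℤ) ∈ window m p t := by
    rw [← abs_le_iff_mem_window]
    simp only [Int.cast_zero, abs_zero]
    positivity
  have hfirst : P * (1 - p) ^ k ≤ 𝔼 L : Fin k → Fin n → range m, cnt p t 0 0 L := by
    refine le_trans ?_ (le_expect_cnt (ρ := 1 - p) (by linarith) 0 (by simp [hk])
      (fun e he => ?_) hwin)
    · refine mul_le_mul_of_nonneg_left ?_ hP0.le
      exact pow_le_pow_of_le_one (by linarith) (by linarith) (by rw [hk]; omega)
    · rw [sub_sub_cancel]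
      exact bound_succ_le hp0 hp1 hm he
  -- Pairs of index tuples that agree in some positions cost a factor `1 / c` for each of them,
  -- which matters only if `c < 1`.
  set y := max 1 (1 / c) with hy
  have hcy : 1 ≤ c * y := by
    calc (1 : ℝ) = c * (1 / c) := by field_simp
      _ ≤ c * y := by gcongr; exact le_max_right _ _
  have hyk : y ^ k ≤ 1 + 1 / c ^ k := by
    have h1 : 0 < 1 / c ^ k := by positivity
    rcases max_choice 1 (1 / c) with h | h
    · rw [hy, h, one_pow]; linarith
    · rw [hy, h, one_div_pow]; linarith
  have hsecond : 𝔼 L : Fin k → Fin n → range m, cnt p t 0 0 L * cnt p t 0 0 L ≤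
      (P ^ 2 + P) * (1 + δ * Q) := by
    refine (expect_cnt_mul_cnt_le (s := s) (y := y) hs0 (le_max_left _ _) 0 (fun e he => ?_)
      0 0).trans ?_
    · have h1 := (peak_mul_width_bounds (n := n) hp0 hp1 hm he.le).1
      have h2 : (1 + 4 * p) ^ (2 ^ e - 1) ≤ Q := by
        refine pow_le_pow_right₀ hR1 ?_
        rw [hk]
        exact (Nat.sub_le _ _).trans (Nat.pow_le_pow_right (by norm_num) he.le)
      have hPe := peak_nonneg n m p e
      have hWe := width_nonneg m p e
      calc (1 : ℝ) ≤ (c * y) ^ 2 ^ e := one_le_pow₀ hcy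
        _ = c ^ 2 ^ e * y ^ 2 ^ e := mul_pow _ _ _
        _ ≤ p * (peak n m p e * width m p e) * (1 + 4 * p) ^ (2 ^ e - 1) * y ^ 2 ^ e := by gcongr
        _ ≤ p * (peak n m p e * width m p e) * Q * y ^ 2 ^ e := by gcongr
        _ = _ := by rw [hs]; ring
    · rw [if_pos rfl, ← hk, ← hP]
      have h1 : (1 + s) ^ (2 * (k - 1)) - 1 ≤ δ := by
        rw [hδ]
        gcongr
        · linarith
        · omega
      have hy0 : 0 ≤ y ^ k := by positivity
      have h2 : P ^ 2 * (1 / c ^ k) ≤ P * Q := by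
        rw [mul_one_div, div_le_iff₀ hck]
        nlinarith
      calc P ^ 2 * (1 + ((1 + s) ^ (2 * (k - 1)) - 1) * y ^ k) + P
          ≤ P ^ 2 * (1 + δ * (1 + 1 / c ^ k)) + P := by gcongr
        _ = P ^ 2 * (1 + δ) + δ * (P ^ 2 * (1 / c ^ k)) + P := by ring
        _ ≤ P ^ 2 * (1 + δ * Q) + δ * (P * Q) + P := by
          gcongr
          exact le_mul_of_one_le_right hδ0 hQ1
        _ = _ := by ring
  have hS0 : 0 ≤ successProb k n m p := MeasureTheory.measureReal_nonneg
  have hp' : 0 ≤ (1 - p) ^ k := pow_nonneg (by linarith) _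
  have hmain : P * ((1 - p) ^ k) ^ 2 ≤ (P + 1) * (1 + δ * Q) * successProb k n m p := by
    refine le_of_mul_le_mul_left ?_ hP0
    calc P * (P * ((1 - p) ^ k) ^ 2) = (P * (1 - p) ^ k) ^ 2 := by ring
      _ ≤ _ := pow_le_pow_left₀ (by positivity) hfirst 2
      _ ≤ _ := sq_expect_cnt_le hk
      _ ≤ (P ^ 2 + P) * (1 + δ * Q) * successProb k n m p := by gcongr
      _ = _ := by ring
  have hD : 0 < 1 + δ * Q := by positivity
  have hmono : c ^ k * (P + 1) ≤ P * (1 + c ^ k) * Q := by nlinarith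
  rw [div_mul_div_comm, div_le_iff₀ (by positivity)]
  refine le_of_mul_le_mul_left ?_ hP0
  calc P * (c ^ k * ((1 - p) ^ k) ^ 2) = c ^ k * (P * ((1 - p) ^ k) ^ 2) := by ring
    _ ≤ c ^ k * ((P + 1) * (1 + δ * Q) * successProb k n m p) := by gcongr
    _ = (c ^ k * (P + 1)) * ((1 + δ * Q) * successProb k n m p) := by ring
    _ ≤ (P * (1 + c ^ k) * Q) * ((1 + δ * Q) * successProb k n m p) := by gcongr
    _ = _ := by ring

theorem complexity_bounds (hk : k = 2 ^ t) (hp0 : 0 < p) (hp1 : p ≤ 1 / 2)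
    (hm : p ^ (t + 1) * m = 1) :
    (k : ℝ) * n * (1 + ∑ d ∈ Finset.Icc 1 t, (p * n) ^ (2 ^ d - 1) / 2 ^ d) *
        ((1 - p) ^ k / (1 + 4 * p) ^ k) ≤ complexity k n m p ∧
      complexity k n m p ≤
        (k : ℝ) * n * (1 + ∑ d ∈ Finset.Icc 1 t, (p * n) ^ (2 ^ d - 1) / 2 ^ d) *
          (1 + 4 * p) ^ k := by
  have hR1 : (1 : ℝ) ≤ 1 + 4 * p := by linarith
  have hsum : (k : ℝ) * n * (1 + ∑ d ∈ Finset.Icc 1 t, (p * n) ^ (2 ^ d - 1) / 2 ^ d) =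
      ∑ d ∈ Finset.range (t + 1), ((k / 2 ^ d : ℕ) : ℝ) * (n * (p * n) ^ (2 ^ d - 1)) := by
    have h1 : (1 : ℝ) + ∑ d ∈ Finset.Icc 1 t, (p * n) ^ (2 ^ d - 1) / 2 ^ d =
        ∑ d ∈ Finset.range (t + 1), (p * n) ^ (2 ^ d - 1) / 2 ^ d := by
      rw [Finset.range_eq_Ico, Finset.sum_eq_sum_Ico_succ_bot (Nat.succ_pos t)]
      simp
      rfl
    rw [h1, Finset.mul_sum]
    refine Finset.sum_congr rfl fun d hd => ?_
    have hd' : d ≤ t := Nat.lt_succ_iff.1 (Finset.mem_range.1 hd)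
    rw [Nat.cast_div (hk ▸ pow_dvd_pow 2 hd') (by positivity)]
    push_cast
    ring
  have hpow : ∀ d, p * (n * (p * n) ^ (2 ^ d - 1)) = (p * n) ^ 2 ^ d := by
    intro d
    rw [← mul_assoc, ← pow_succ', Nat.sub_add_cancel Nat.one_le_two_pow]
  have hle : ∀ d ∈ Finset.range (t + 1), d ≤ t ∧ 2 ^ d - 1 ≤ k := fun d hd => by
    have hd' : d ≤ t := Nat.lt_succ_iff.1 (Finset.mem_range.1 hd)
    have := Nat.pow_le_pow_right (n := 2) (by norm_num) hd'
    exact ⟨hd', by omega⟩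
  rw [hsum, complexity_eq hk, Finset.sum_mul, Finset.sum_mul]
  constructor
  · refine Finset.sum_le_sum fun d hd => ?_
    obtain ⟨hd, hd2⟩ := hle d hd
    have hb := (peak_mul_width_bounds (n := n) hp0 hp1 hm hd).1
    have hP := peak_nonneg n m p d
    have hW := width_nonneg m p d
    rw [← hpow] at hb
    have hp' : 0 ≤ (1 - p) ^ k := pow_nonneg (by linarith) _
    have hs : n * (p * n) ^ (2 ^ d - 1) * ((1 - p) ^ k / (1 + 4 * p) ^ k) ≤
        width m p d * (peak n m p d * (1 - p) ^ (2 ^ d - 1)) := by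
      have hb' : n * (p * n) ^ (2 ^ d - 1) ≤
          peak n m p d * width m p d * (1 + 4 * p) ^ k := by
        refine le_of_mul_le_mul_left (hb.trans ?_) hp0
        rw [mul_assoc p]
        gcongr
      have hpp : (1 - p) ^ k ≤ (1 - p) ^ (2 ^ d - 1) :=
        pow_le_pow_of_le_one (by linarith) (by linarith) hd2
      rw [mul_div_assoc', div_le_iff₀ (by positivity)]
      calc _ ≤ peak n m p d * width m p d * (1 + 4 * p) ^ k * (1 - p) ^ (2 ^ d - 1) := by gcongr
        _ = _ := by ring
    rw [mul_assoc]
    refine (mul_le_mul_of_nonneg_left hs (Nat.cast_nonneg _)).trans ?_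
    rw [← nsmul_eq_mul]
    nth_rewrite 1 [← Finset.card_range (k / 2 ^ d)]
    refine Finset.card_nsmul_le_sum _ _ _ fun i hi => ?_
    rw [width, ← nsmul_eq_mul]
    refine Finset.card_nsmul_le_sum _ _ _ fun x hx => ?_
    refine le_expect_cnt (by linarith) i ?_ (fun e he => ?_) hx
    · have : i + 1 ≤ k / 2 ^ d := by simpa using hi
      exact (Nat.mul_le_mul_right _ this).trans (Nat.div_mul_le_self _ _)
    · rw [sub_sub_cancel]
      exact bound_succ_le hp0 hp1 hm (he.trans_le hd)
  · refine Finset.sum_le_sum fun d hd => ?_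
    obtain ⟨hd, hd2⟩ := hle d hd
    have hb := (peak_mul_width_bounds (n := n) hp0 hp1 hm hd).2
    rw [← hpow] at hb
    have hs : width m p d * peak n m p d ≤ n * (p * n) ^ (2 ^ d - 1) * (1 + 4 * p) ^ k := by
      refine le_of_mul_le_mul_left (le_trans (le_of_eq ?_) (hb.trans ?_)) hp0
      · ring
      · rw [mul_assoc p]
        gcongr
    calc _ ≤ ∑ i ∈ Finset.range (k / 2 ^ d), ∑ x ∈ window m p d, peak n m p d :=
          Finset.sum_le_sum fun i _ => Finset.sum_le_sum fun x _ => expect_cnt_le d i x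
      _ = ((k / 2 ^ d : ℕ) : ℝ) * (width m p d * peak n m p d) := by
          simp [width]
      _ ≤ ((k / 2 ^ d : ℕ) : ℝ) * (n * (p * n) ^ (2 ^ d - 1) * (1 + 4 * p) ^ k) := by gcongr
      _ = _ := by ring

end Estimates

/-! ### Asymptotics -/

theorem filterParam_pow_mul {k m : ℕ} (hm : 0 < m) :
    filterParam k m ^ (Nat.log 2 k + 1) * m = 1 := by
  have hm' : (0 : ℝ) < m := Nat.cast_pos.2 hm
  have h1 : ((Nat.log 2 k : ℝ) + 1) ≠ 0 := by positivity
  rw [filterParam, ← Real.rpow_natCast, ← Real.rpow_mul hm'.le]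
  push_cast
  rw [div_mul_cancel₀ _ h1, Real.rpow_neg_one, inv_mul_cancel₀ hm'.ne']

theorem tendsto_one_add_pow {a : ℕ → ℝ} {k : ℕ → ℕ} (ha : ∀ᶠ m in atTop, 0 ≤ a m)
    (h : Tendsto (fun m => k m * a m) atTop (𝓝 0)) :
    Tendsto (fun m => (1 + a m) ^ k m) atTop (𝓝 1) := by
  refine tendsto_of_tendsto_of_tendsto_of_le_of_le' tendsto_const_nhds
    (h := fun m => Real.exp (k m * a m)) ?_ ?_ ?_
  · have := (Real.continuous_exp.tendsto 0).comp h
    rwa [Real.exp_zero] at this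
  · filter_upwards [ha] with m hm using one_le_pow₀ (by linarith)
  · filter_upwards [ha] with m hm
    rw [Real.exp_nat_mul]
    refine pow_le_pow_left₀ (by linarith) ?_ _
    linarith [Real.add_one_le_exp (a m)]

theorem tendsto_one_sub_pow {a : ℕ → ℝ} {k : ℕ → ℕ} (ha : ∀ᶠ m in atTop, 0 ≤ a m ∧ a m ≤ 1)
    (h : Tendsto (fun m => k m * a m) atTop (𝓝 0)) :
    Tendsto (fun m => (1 - a m) ^ k m) atTop (𝓝 1) := by
  refine tendsto_of_tendsto_of_tendsto_of_le_of_le' (g := fun m => 1 - k m * a m)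
    (h := fun _ => 1) ?_ tendsto_const_nhds ?_ ?_
  · simpa using tendsto_const_nhds.sub h
  · filter_upwards [ha] with m hm
    have := one_add_mul_le_pow (a := -a m) (by linarith [hm.2]) (k m)
    rw [← sub_eq_add_neg] at this
    linarith
  · filter_upwards [ha] with m hm using pow_le_one₀ (by linarith [hm.2]) (by linarith [hm.1])

end KTree

theorem corollary2p2 (k n : ℕ → ℕ) (p c : ℕ → ℝ)
    (hk : ∀ m, 4 ≤ k m ∧ ∃ j : ℕ, k m = 2 ^ j)
    (hp : ∀ m, p m = KTree.filterParam (k m) m)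
    (hc : ∀ m, c m = p m * n m)
    (hkp : (fun m => (k m : ℝ)) =o[atTop] fun m => 1 / p m)
    (hkn : (fun m => (k m : ℝ)) =o[atTop] fun m => (n m : ℝ) ^ (1 / 2 : ℝ)) :
    (∃ ε : ℕ → ℝ, ε =o[atTop] (fun _ => (1 : ℝ)) ∧ ∀ᶠ m in atTop,
      c m ^ k m / (1 + c m ^ k m) * (1 - ε m) ≤ KTree.successProb (k m) (n m) m (p m)) ∧
    (∃ ε : ℕ → ℝ, ε =o[atTop] (fun _ => (1 : ℝ)) ∧ ∀ᶠ m in atTop,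
      KTree.successProb (k m) (n m) m (p m) ≤ c m ^ k m * (1 + ε m)) ∧
    (∃ ε : ℕ → ℝ, ε =o[atTop] (fun _ => (1 : ℝ)) ∧ ∀ᶠ m in atTop,
      KTree.complexity (k m) (n m) m (p m) ∈ Set.Icc
        ((k m : ℝ) * n m *
          (1 + ∑ d ∈ Finset.Icc 1 (Nat.log 2 (k m)), c m ^ (2 ^ d - 1) / 2 ^ d) * (1 - ε m))
        ((k m : ℝ) * n m *
          (1 + ∑ d ∈ Finset.Icc 1 (Nat.log 2 (k m)), c m ^ (2 ^ d - 1) / 2 ^ d) * (1 + ε m))) := by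
  have hkt : ∀ m, k m = 2 ^ Nat.log 2 (k m) := fun m => by
    obtain ⟨j, hj⟩ := (hk m).2
    rw [hj, Nat.log_pow Nat.one_lt_two]
  have hk4 : ∀ m, (4 : ℝ) ≤ k m := fun m => by exact_mod_cast (hk m).1
  have hkp0 : Tendsto (fun m => (k m : ℝ) * p m) atTop (𝓝 0) := by
    simpa using hkp.tendsto_div_nhds_zero
  have hp0 : ∀ᶠ m in atTop, 0 < p m := by
    filter_upwards [eventually_gt_atTop 0] with m hm
    rw [hp, KTree.filterParam]
    exact Real.rpow_pos_of_pos (Nat.cast_pos.2 hm) _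
  have hp1 : ∀ᶠ m in atTop, p m ≤ 1 / 2 := by
    filter_upwards [hp0, hkp0.eventually (eventually_lt_nhds one_pos)] with m h0 h1
    nlinarith [hk4 m]
  have hpm : ∀ᶠ m : ℕ in atTop, p m ^ (Nat.log 2 (k m) + 1) * m = 1 := by
    filter_upwards [eventually_gt_atTop 0] with m hm
    rw [hp]
    exact KTree.filterParam_pow_mul hm
  have hn : ∀ᶠ m in atTop, 0 < n m := by
    filter_upwards [hkn.bound one_pos] with m hm
    by_contra h
    have h0 : n m = 0 := by omega
    rw [h0] at hm
    norm_num at hm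
    have := (hk m).1
    omega
  have hA : Tendsto (fun m => (1 - p m) ^ k m) atTop (𝓝 1) := by
    refine KTree.tendsto_one_sub_pow ?_ hkp0
    filter_upwards [hp0, hp1] with m h0 h1
    constructor <;> linarith
  have hQ : Tendsto (fun m => (1 + 4 * p m) ^ k m) atTop (𝓝 1) := by
    refine KTree.tendsto_one_add_pow ?_ ?_
    · filter_upwards [hp0] with m h0
      positivity
    · have := hkp0.const_mul 4
      rw [mul_zero] at this
      exact this.congr fun m => by ring
  have hV : Tendsto (fun m => (1 + p m * (1 + 4 * p m) ^ k m) ^ (2 * k m)) atTop (𝓝 1) := by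
    refine KTree.tendsto_one_add_pow ?_ ?_
    · filter_upwards [hp0] with m h0
      positivity
    · have := (hkp0.mul hQ).const_mul 2
      rw [zero_mul, mul_zero] at this
      refine this.congr fun m => ?_
      push_cast
      ring
  refine ⟨⟨fun m => 1 - ((1 - p m) ^ k m) ^ 2 / ((1 + 4 * p m) ^ k m *
      (1 + ((1 + p m * (1 + 4 * p m) ^ k m) ^ (2 * k m) - 1) * (1 + 4 * p m) ^ k m)), ?_, ?_⟩,
    ⟨fun m => (1 + 4 * p m) ^ k m - 1, ?_, ?_⟩,
    ⟨fun m => ((1 + 4 * p m) ^ k m - 1) + (1 - (1 - p m) ^ k m / (1 + 4 * p m) ^ k m), ?_, ?_⟩⟩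
  · rw [isLittleO_one_iff]
    have hden := hQ.mul (((hV.sub_const 1).mul hQ).const_add 1)
    have := ((hA.pow 2).div hden (by norm_num)).const_sub 1
    simpa using this
  · filter_upwards [hp0, hp1, hpm, hn] with m h0 h1 h2 h3
    rw [sub_sub_cancel, hc]
    exact KTree.le_successProb (hkt m) h3 h0 h1 h2
  · rw [isLittleO_one_iff]
    simpa using hQ.sub_const 1
  · filter_upwards [hp0, hp1, hpm] with m h0 h1 h2
    rw [add_sub_cancel, hc]
    refine (KTree.successProb_le (hkt m)).trans ?_
    have := (KTree.peak_bounds (n := n m) h0 h1 h2).2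
    rwa [← hkt m] at this
  · rw [isLittleO_one_iff]
    have := (hQ.sub_const 1).add ((hA.div hQ one_ne_zero).const_sub 1)
    simpa using this
  · filter_upwards [hp0, hp1, hpm] with m h0 h1 h2
    have hb := KTree.complexity_bounds (n := n m) (hkt m) h0 h1 h2
    have hQ1 : 1 ≤ (1 + 4 * p m) ^ k m := one_le_pow₀ (by linarith)
    have hA0 : 0 ≤ (1 - p m) ^ k m := pow_nonneg (by linarith) _
    have hA1 : (1 - p m) ^ k m / (1 + 4 * p m) ^ k m ≤ 1 :=
      (div_le_one (by linarith)).2 <|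
        (pow_le_one₀ (by linarith) (by linarith)).trans hQ1
    rw [hc]
    have hK : 0 ≤ (k m : ℝ) * n m *
        (1 + ∑ d ∈ Finset.Icc 1 (Nat.log 2 (k m)), (p m * n m) ^ (2 ^ d - 1) / 2 ^ d) := by
      positivity
    exact ⟨(mul_le_mul_of_nonneg_left (by linarith) hK).trans hb.1,
      hb.2.trans (mul_le_mul_of_nonneg_left (by linarith) hK)⟩
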